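/- **Theorem 3.** Let $X_1$ and $X_2$ be connected and locally path connected topological spaces, and let $x_1\in X_1$, $x_2\in X_2$ be base points such that $\{x_1\}$ is closed in $X_1$ and $\{x_2\}$ is closed in $X_2$. Let $X_1\vee X_2=(X_1\sqcup X_2)/(x_1\sim x_2)$ be their one-point union, with the quotient topology. Then $X_1\vee X_2$ has a categorical universal covering if and only if both $X_1$ and $X_2$ have one. Here a *covering* of a space $X$ is a surjective map $p:E\to X$ such that every point of $X$ has an evenly covered open neighbourhood, and a *categorical universal covering* of $X$ is a covering $p:\widetilde X\to X$ with $\widetilde X$ path connected such that for every covering $q:\widetilde Y\to X$ with $\widetilde Y$ path connected there is a covering $f:\widetilde X\to\widetilde Y$ with $q\circ f=p$, and $f$ is unique up to equivalence: if $g:\widetilde X\to\widetilde Y$ is another covering with $q\circ g=p$, then $g\circ h=f$ for some homeomorphism $h:\widetilde X\to\widetilde X$. -/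

import Mathlib

universe u v

/-- A covering projection `p : E → X`: every point of `X` has an evenly covered open neighbourhood
(Mathlib's `IsCoveringMap`, which alone would allow empty fibres), and `p` is onto. -/
structure IsCoveringProjection {E : Type u} {X : Type v} [TopologicalSpace E] [TopologicalSpace X]
    (p : E → X) : Prop where
  isCoveringMap : IsCoveringMap p
  surjective : Function.Surjective p

/-- `p : E → X` is a (categorical) universal covering: `E` is path connected, `p` is a covering, and
for every covering `q : Y → X` with `Y` path connected there is a covering `f : E → Y` with
`q ∘ f = p`, and `f` is unique up to equivalence of coverings of `Y`. -/
structure IsCategoricalUniversalCovering {E X : Type u} [TopologicalSpace E] [TopologicalSpace X]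
    (p : E → X) : Prop where
  pathConnectedSpace : PathConnectedSpace E
  isCoveringProjection : IsCoveringProjection p
  exists_unique_lift : ∀ (Y : Type u) [TopologicalSpace Y] [PathConnectedSpace Y] (q : Y → X),
    IsCoveringProjection q →
      ∃ f : E → Y, IsCoveringProjection f ∧ q ∘ f = p ∧
        ∀ g : E → Y, IsCoveringProjection g → q ∘ g = p → ∃ h : E ≃ₜ E, g ∘ h = f

/-- The space `X` has a categorical universal covering. (Path connected covering spaces of a space in
`Type u` have the size of a type in `Type u`, so restricting to this universe loses nothing.) -/
def HasCategoricalUniversalCovering (X : Type u) [TopologicalSpace X] : Prop :=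
  ∃ (E : Type u) (_ : TopologicalSpace E) (p : E → X), IsCategoricalUniversalCovering p

/-- The relation on the disjoint union `X₁ ⊕ X₂` that identifies the two base points. -/
inductive BasePointRel {X₁ : Type u} {X₂ : Type v} (x₁ : X₁) (x₂ : X₂) :
    X₁ ⊕ X₂ → X₁ ⊕ X₂ → Prop
  | glue : BasePointRel x₁ x₂ (Sum.inl x₁) (Sum.inr x₂)

/-- The one-point union `X₁ ∨ X₂ = (X₁ ⊔ X₂) / (x₁ ∼ x₂)`: the quotient of the disjoint union by
the equivalence relation generated by `x₁ ∼ x₂`. -/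
def OnePointUnion {X₁ : Type u} {X₂ : Type v} (x₁ : X₁) (x₂ : X₂) : Type (max u v) :=
  Quot (BasePointRel x₁ x₂)

/-- The one-point union carries the quotient topology of the disjoint union topology. -/
instance OnePointUnion.instTopologicalSpace {X₁ : Type u} {X₂ : Type v} [TopologicalSpace X₁]
    [TopologicalSpace X₂] (x₁ : X₁) (x₂ : X₂) : TopologicalSpace (OnePointUnion x₁ x₂) :=
  inferInstanceAs (TopologicalSpace (Quot (BasePointRel x₁ x₂)))

open Set Topology

universe w

/-! ### Criteria for covering maps -/

/-! For connected, locally path connected `X`, having a categorical universal covering is equivalent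
to a local condition, `HasUniformSections`: each point has an open neighbourhood `U` over which
every covering of `X` has sections through all points above `U`. No simple connectivity is involved.

Given a universal covering `p`, take `U` evenly covered by `p`. The component of any point of a
covering space is the image of a lift of `p`, so sections of `p` over `U` push forward to it.
Conversely, identify paths from `x₀` whose lifts end at the same point in every covering. Uniform
sections say that paths with common endpoints inside a small set are identified, which makes the
endpoint map a covering; it maps to every covering by path lifting.

The local condition suits the one-point union. It passes to a retract by pulling coverings back
along the retraction (`HasUniformSections.of_retract`). In the other direction, points off the base
point have neighbourhoods in one summand, and at the base point two sections are made to agree there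
and glued (`OnePointUnion.hasUniformSections`). -/

theorem IsEvenlyCovered.of_sheets {E X ι : Type*} [TopologicalSpace E] [TopologicalSpace X]
    {f : E → X} {x : X} {V : Set X} (hV : IsOpen V) (hx : x ∈ V) (U : ι → Set E)
    (open_iff : ∀ i {W}, W ⊆ V → (IsOpen W ↔ IsOpen (f ⁻¹' W ∩ U i)))
    (inj : ∀ i, (U i).InjOn f) (surj : ∀ i, (U i).SurjOn f V)
    (disjoint : ∀ i j e, e ∈ U i → e ∈ U j → i = j) (exhaustive : ∀ e, f e ∈ V → ∃ i, e ∈ U i) :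
    IsEvenlyCovered f x (f ⁻¹' {x}) := by
  rcases isEmpty_or_nonempty ι with hι | hι
  -- With no sheets nothing lies over `V`, and the fibre is empty.
  · refine IsEvenlyCovered.to_isEvenlyCovered_preimage
      (.of_preimage_eq_empty Empty (hV.mem_nhds hx) ?_)
    refine eq_empty_of_forall_notMem fun e he ↦ ?_
    obtain ⟨i, -⟩ := exhaustive e he
    exact hι.elim i
  · let _ : TopologicalSpace ι := ⊥
    have : DiscreteTopology ι := ⟨rfl⟩
    have : Nonempty E := ⟨(surj (Classical.arbitrary ι) hx).choose⟩
    refine IsEvenlyCovered.to_isEvenlyCovered_preimage (.of_trivialization (I := ι)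
      (t := hV.trivializationDiscrete U V open_iff inj surj ?_ ?_) hx)
    · intro i j hij
      exact Set.disjoint_left.mpr fun e hi hj ↦ hij (disjoint i j e hi hj)
    · exact fun e he ↦ mem_iUnion.mpr (exhaustive e he)

/-- The map `q` has a section over `U` that passes through `y`. -/
def HasSectionThrough {X Y : Type*} [TopologicalSpace X] [TopologicalSpace Y] (q : Y → X)
    (U : Set X) (y : Y) : Prop :=
  ∃ s : X → Y, ContinuousOn s U ∧ (∀ x ∈ U, q (s x) = x) ∧ s (q y) = y

theorem HasSectionThrough.mono {X Y : Type*} [TopologicalSpace X] [TopologicalSpace Y] {q : Y → X}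
    {U V : Set X} {y : Y} (h : HasSectionThrough q U y) (hVU : V ⊆ U) :
    HasSectionThrough q V y :=
  let ⟨s, hs, hqs, hy⟩ := h
  ⟨s, hs.mono hVU, fun x hx ↦ hqs x (hVU hx), hy⟩

/-- Composing `s` with the local homeomorphism `q` gives the open inclusion of `U`, so `s` is itself
an open embedding on `U`. -/
theorem IsLocalHomeomorph.isOpen_image_section {X Y : Type*} [TopologicalSpace X]
    [TopologicalSpace Y] {q : Y → X} (hq : IsLocalHomeomorph q) {U W : Set X} (hU : IsOpen U)
    {s : X → Y} (hs : ContinuousOn s U) (hqs : ∀ x ∈ U, q (s x) = x) (hW : IsOpen W)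
    (hWU : W ⊆ U) : IsOpen (s '' W) := by
  have hemb : IsOpenEmbedding (U.domRestrict s) := by
    refine hq.isOpenEmbedding_of_comp ?_ hs.domRestrict
    have : q ∘ U.domRestrict s = Subtype.val := funext fun x ↦ hqs x x.2
    rw [this]
    exact hU.isOpenEmbedding_subtypeVal
  have : s '' W = U.domRestrict s '' (Subtype.val ⁻¹' W) := by
    ext y
    constructor
    · rintro ⟨x, hx, rfl⟩
      exact ⟨⟨x, hWU hx⟩, hx, rfl⟩
    · rintro ⟨x, hx, rfl⟩
      exact ⟨x, hx, rfl⟩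
  rw [this]
  exact hemb.isOpenMap _ (hW.preimage continuous_subtype_val)

/-- The sheets are the images of sections through the points of one fibre. Since `U` is
preconnected, sections that agree at one point agree on `U`; hence the sheets are disjoint and
exhaust the preimage. -/
theorem IsCoveringMap.of_hasSectionThrough {X Y : Type*} [TopologicalSpace X] [TopologicalSpace Y]
    {q : Y → X} (hq : IsLocalHomeomorph q) (hsep : IsSeparatedMap q)
    (h : ∀ x, ∃ U, IsOpen U ∧ x ∈ U ∧ IsPreconnected U ∧
      ∀ y, q y ∈ U → HasSectionThrough q U y) : IsCoveringMap q := by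
  intro x
  obtain ⟨U, hU, hxU, hconn, hsec⟩ := h x
  have key : ∀ y : q ⁻¹' {x}, ∃ s : X → Y, ContinuousOn s U ∧ (∀ z ∈ U, q (s z) = z) ∧
      s x = y := by
    rintro ⟨y, rfl⟩
    exact hsec y hxU
  choose s hs hqs hsx using key
  have huniq : ∀ {s t : X → Y}, ContinuousOn s U → ContinuousOn t U → (∀ z ∈ U, q (s z) = z) →
      (∀ z ∈ U, q (t z) = z) → ∀ {z}, z ∈ U → s z = t z → EqOn s t U := by
    intro s t hs ht hqs hqt z hz hst
    exact hsep.eqOn_of_comp_eqOn hq.isLocallyInjective hconn hs ht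
      (fun w hw ↦ (hqs w hw).trans (hqt w hw).symm) hz hst
  refine IsEvenlyCovered.of_sheets hU hxU (fun y ↦ s y '' U) ?_ ?_ ?_ ?_ ?_
  · intro y W hW
    have heq : q ⁻¹' W ∩ s y '' U = s y '' W := by
      ext z
      constructor
      · rintro ⟨hz, w, hw, rfl⟩
        rw [mem_preimage, hqs y w hw] at hz
        exact ⟨w, hz, rfl⟩
      · rintro ⟨w, hw, rfl⟩
        exact ⟨by rwa [mem_preimage, hqs y w (hW hw)], w, hW hw, rfl⟩
    rw [heq]
    refine ⟨fun hWo ↦ hq.isOpen_image_section hU (hs y) (hqs y) hWo hW, fun ho ↦ ?_⟩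
    have := hq.isOpenMap _ ho
    rwa [image_image, image_congr (fun w hw ↦ hqs y w (hW hw)), image_id'] at this
  · rintro y _ ⟨a, ha, rfl⟩ _ ⟨b, hb, rfl⟩ hab
    rw [hqs y a ha, hqs y b hb] at hab
    rw [hab]
  · exact fun y z hz ↦ ⟨s y z, ⟨z, hz, rfl⟩, hqs y z hz⟩
  · rintro y y' _ ⟨a, ha, rfl⟩ ⟨b, hb, hab⟩
    have : b = a := by rw [← hqs y a ha, ← hab, hqs y' b hb]
    subst this
    apply Subtype.ext
    rw [← hsx y, ← hsx y']
    exact huniq (hs y) (hs y') (hqs y) (hqs y') ha hab.symm hxU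
  · intro y hy
    obtain ⟨t, ht, hqt, hty⟩ := hsec y hy
    refine ⟨⟨t x, hqt x hxU⟩, q y, hy, ?_⟩
    rw [← hty, hqt _ hy]
    exact huniq (hs _) ht (hqs _) hqt hxU (hsx _) hy

theorem IsCoveringMap.exists_hasSectionThrough {X Y : Type*} [TopologicalSpace X]
    [TopologicalSpace Y] {q : Y → X} (hq : IsCoveringMap q) (x : X) :
    ∃ U, IsOpen U ∧ x ∈ U ∧ ∀ y, q y ∈ U → HasSectionThrough q U y := by
  obtain ⟨-, U, hxU, hU, -, H, hH⟩ := hq x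
  refine ⟨U, hU, hxU, fun y hy ↦ ?_⟩
  classical
  let i := (H ⟨y, hy⟩).2
  -- The section stays in the sheet of `y`; its value off `U` is irrelevant.
  refine ⟨fun z ↦ if hz : z ∈ U then (H.symm (⟨z, hz⟩, i)).1 else y, ?_, ?_, ?_⟩
  · rw [continuousOn_iff_continuous_domRestrict]
    refine (show Continuous fun z : U ↦ (H.symm (z, i)).1 by fun_prop).congr fun z ↦ ?_
    simp
  · intro z hz
    simp only [hz, dif_pos]
    rw [← hH]
    simp
  · simp only [hy, dif_pos]
    have : ((⟨q y, hy⟩ : U), i) = H ⟨y, hy⟩ := Prod.ext (Subtype.ext (hH ⟨y, hy⟩).symm) rfl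
    rw [this, H.symm_apply_apply]

theorem LocallyPathConnectedSpace.exists_isPathConnected {X : Type*} [TopologicalSpace X]
    [LocallyPathConnectedSpace X] {U : Set X} (hU : IsOpen U) {x : X} (hx : x ∈ U) :
    ∃ V ⊆ U, IsOpen V ∧ x ∈ V ∧ IsPathConnected V :=
  ⟨pathComponentIn U x, pathComponentIn_subset, hU.pathComponentIn x, mem_pathComponentIn_self hx,
    isPathConnected_pathComponentIn hx⟩

/-- A continuous map between covering spaces of a locally path connected space, over that space,
is a covering map. -/
theorem IsCoveringMap.of_comp {X Y E : Type*} [TopologicalSpace X] [TopologicalSpace Y]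
    [TopologicalSpace E] [LocallyPathConnectedSpace X] {q : Y → X} {f : E → Y}
    (hq : IsCoveringMap q) (hp : IsCoveringMap (q ∘ f)) (hf : Continuous f) : IsCoveringMap f := by
  refine .of_hasSectionThrough (hp.isLocalHomeomorph.of_comp hq.isLocalHomeomorph hf) ?_ ?_
  · exact fun a b hab hne ↦ hp.isSeparatedMap a b (congrArg q hab) hne
  · intro y
    obtain ⟨U₁, hU₁, hy₁, hs₁⟩ := hq.exists_hasSectionThrough (q y)
    obtain ⟨U₂, hU₂, hy₂, hs₂⟩ := hp.exists_hasSectionThrough (q y)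
    obtain ⟨U, hUU, hU, hyU, hconn⟩ :=
      LocallyPathConnectedSpace.exists_isPathConnected (hU₁.inter hU₂) ⟨hy₁, hy₂⟩
    obtain ⟨t, ht, hqt, hty⟩ := (hs₁ y hy₁).mono (hUU.trans inter_subset_left)
    refine ⟨t '' U, hq.isLocalHomeomorph.isOpen_image_section hU ht hqt hU subset_rfl,
      ⟨q y, hyU, hty⟩, hconn.isConnected.isPreconnected.image t ht, ?_⟩
    rintro e ⟨z, hz, hze⟩
    have hez : q (f e) = z := by rw [← hze, hqt z hz]
    obtain ⟨s, hs, hps, hse⟩ := (hs₂ e (show q (f e) ∈ U₂ from hez ▸ (hUU hz).2)).mono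
      (hUU.trans inter_subset_right)
    -- Both are lifts of the inclusion of `U` along `q` and agree at `z`. Hence `s ∘ q` is a section
    -- of `f` over `t '' U`.
    have hfs : EqOn (f ∘ s) t U := by
      refine hq.eqOn_of_comp_eqOn hconn.isConnected.isPreconnected (hf.comp_continuousOn hs) ht
        (fun w hw ↦ (hps w hw).trans (hqt w hw).symm) hz ?_
      rw [Function.comp_apply, ← hez, show q (f e) = (q ∘ f) e from rfl, hse, ← hze]
      exact congrArg t hez.symm
    have hmaps : MapsTo q (t '' U) U := by
      rintro _ ⟨w, hw, rfl⟩
      rwa [hqt w hw]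
    refine ⟨s ∘ q, hs.comp hq.continuous.continuousOn hmaps, ?_, hse⟩
    rintro _ ⟨w, hw, rfl⟩
    rw [Function.comp_apply, hqt w hw]
    exact hfs hw

/-- A section over a connected set that meets the clopen set `C` stays in `C`. -/
theorem IsCoveringMap.domRestrict_isClopen {X Y : Type*} [TopologicalSpace X] [TopologicalSpace Y]
    [LocallyPathConnectedSpace X] {q : Y → X} (hq : IsCoveringMap q) {C : Set Y}
    (hC : IsClopen C) : IsCoveringMap (C.domRestrict q) := by
  refine .of_hasSectionThrough ?_ ?_ ?_
  · exact hq.isLocalHomeomorph.comp hC.isOpen.isOpenEmbedding_subtypeVal.isLocalHomeomorph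
  · intro a b hab hne
    obtain ⟨s, t, hs, ht, has, hbt, hd⟩ := hq.isSeparatedMap a b hab (Subtype.coe_ne_coe.mpr hne)
    exact ⟨_, _, hs.preimage continuous_subtype_val, ht.preimage continuous_subtype_val, has, hbt,
      hd.preimage _⟩
  · intro x
    obtain ⟨U₁, hU₁, hx₁, hs₁⟩ := hq.exists_hasSectionThrough x
    obtain ⟨U, hUU, hU, hxU, hconn⟩ := LocallyPathConnectedSpace.exists_isPathConnected hU₁ hx₁
    refine ⟨U, hU, hxU, hconn.isConnected.isPreconnected, fun y hy ↦ ?_⟩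
    obtain ⟨s, hs, hqs, hsy⟩ := (hs₁ y (hUU hy)).mono hUU
    have hmem : ∀ z ∈ U, s z ∈ C := by
      have := (hconn.isConnected.isPreconnected.image s hs).subset_isClopen hC
        ⟨y, ⟨_, hy, hsy⟩, y.2⟩
      exact fun z hz ↦ this ⟨z, hz, rfl⟩
    classical
    refine ⟨fun z ↦ if hz : z ∈ U then ⟨s z, hmem z hz⟩ else y, ?_, ?_, ?_⟩
    · rw [continuousOn_iff_continuous_domRestrict]
      refine (Continuous.subtype_mk hs.domRestrict fun z ↦ hmem z z.2).congr fun z ↦ ?_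
      simp
    · intro z hz
      simpa [hz] using hqs z hz
    · refine (dif_pos hy).trans ?_
      exact Subtype.ext hsy

theorem IsEvenlyCovered.pullback_fst {A X Y I : Type*} [TopologicalSpace A] [TopologicalSpace X]
    [TopologicalSpace Y] [TopologicalSpace I] {f : A → X} (hf : Continuous f) {q : Y → X} {a : A}
    (h : IsEvenlyCovered q (f a) I) :
    IsEvenlyCovered (Function.Pullback.fst : f.Pullback q → A) a I := by
  obtain ⟨hI, U, haU, hU, hqU, H, hH⟩ := h
  have hfst : Continuous (Function.Pullback.fst : f.Pullback q → A) :=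
    continuous_fst.comp continuous_subtype_val
  refine ⟨hI, f ⁻¹' U, haU, hU.preimage hf, (hU.preimage hf).preimage hfst, ?_, ?_⟩
  · refine
    { toFun z := (⟨z.1.1.1, z.2⟩, (H ⟨z.1.1.2, ?_⟩).2)
      invFun w := ⟨⟨(w.1.1, (H.symm (⟨f w.1.1, w.1.2⟩, w.2)).1), ?_⟩, w.1.2⟩
      left_inv z := ?_
      right_inv w := ?_
      continuous_toFun := ?_
      continuous_invFun := ?_ }
    · have := z.1.2
      have h2 : f z.1.1.1 ∈ U := z.2
      rw [mem_preimage, ← this]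
      exact h2
    · change f w.1.1 = q _
      rw [← hH]
      simp
    · apply Subtype.ext
      apply Subtype.ext
      refine Prod.ext rfl ?_
      have hz : f z.1.1.1 = q z.1.1.2 := z.1.2
      have hzU : f z.1.1.1 ∈ U := z.2
      have hzq : q z.1.1.2 ∈ U := hz ▸ hzU
      have : ((⟨f z.1.1.1, hzU⟩ : U), (H ⟨z.1.1.2, hzq⟩).2) = H ⟨z.1.1.2, hzq⟩ :=
        Prod.ext (Subtype.ext (hz.trans (hH ⟨z.1.1.2, hzq⟩).symm)) rfl
      change (H.symm ((⟨f z.1.1.1, hzU⟩ : U), (H ⟨z.1.1.2, hzq⟩).2)).1 = z.1.1.2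
      rw [this, H.symm_apply_apply]
    · refine Prod.ext rfl ?_
      change (H ⟨(H.symm (⟨f w.1.1, w.1.2⟩, w.2)).1, _⟩).2 = w.2
      simp
    · fun_prop
    · fun_prop
  · intro z
    rfl

theorem IsCoveringMap.pullback_fst {A X Y : Type*} [TopologicalSpace A] [TopologicalSpace X]
    [TopologicalSpace Y] {f : A → X} (hf : Continuous f) {q : Y → X} (hq : IsCoveringMap q) :
    IsCoveringMap (Function.Pullback.fst : f.Pullback q → A) :=
  fun a ↦ ((hq (f a)).pullback_fst hf).to_isEvenlyCovered_preimage

/-! ### Lifts of paths -/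

/-- The path `γ` lifts along `q` to a path from `y` to `z`. -/
def Path.LiftsTo {X Y : Type*} [TopologicalSpace X] [TopologicalSpace Y] {a b : X} (γ : Path a b)
    (q : Y → X) (y z : Y) : Prop :=
  ∃ Γ : Path y z, ∀ t, q (Γ t) = γ t

section LiftsTo

variable {X Y : Type*} [TopologicalSpace X] [TopologicalSpace Y] {a b c : X} {γ : Path a b}
  {δ : Path b c} {q : Y → X} {x y z : Y}

theorem Path.LiftsTo.source (h : γ.LiftsTo q y z) : q y = a := by
  obtain ⟨Γ, hΓ⟩ := h
  simpa using hΓ 0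

theorem Path.LiftsTo.target (h : γ.LiftsTo q y z) : q z = b := by
  obtain ⟨Γ, hΓ⟩ := h
  simpa using hΓ 1

theorem Path.LiftsTo.trans (h₁ : γ.LiftsTo q x y) (h₂ : δ.LiftsTo q y z) :
    (γ.trans δ).LiftsTo q x z := by
  obtain ⟨Γ, hΓ⟩ := h₁
  obtain ⟨Δ, hΔ⟩ := h₂
  refine ⟨Γ.trans Δ, fun t ↦ ?_⟩
  rw [Path.trans_apply, Path.trans_apply]
  split_ifs
  exacts [hΓ _, hΔ _]

theorem Path.LiftsTo.symm (h : γ.LiftsTo q x y) : γ.symm.LiftsTo q y x := by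
  obtain ⟨Γ, hΓ⟩ := h
  exact ⟨Γ.symm, fun t ↦ hΓ _⟩

theorem Path.LiftsTo.refl (h : q y = a) : (Path.refl a).LiftsTo q y y :=
  ⟨Path.refl y, fun _ ↦ h⟩

theorem Path.LiftsTo.of_section {U : Set X} {s : X → Y} (hs : ContinuousOn s U)
    (hqs : ∀ x ∈ U, q (s x) = x) (hγ : ∀ t, γ t ∈ U) : γ.LiftsTo q (s a) (s b) := by
  refine ⟨⟨⟨fun t ↦ s (γ t), hs.comp_continuous γ.continuous hγ⟩, ?_, ?_⟩, fun t ↦ hqs _ (hγ t)⟩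
  · simp
  · simp

theorem IsCoveringMap.exists_liftsTo (hq : IsCoveringMap q) (γ : Path a b) (hy : q y = a) :
    ∃ z, γ.LiftsTo q y z := by
  obtain ⟨Γ, hΓ, hΓ0⟩ := hq.exists_path_lifts γ y (by simp [hy])
  exact ⟨Γ 1, ⟨Γ, hΓ0, rfl⟩, fun t ↦ congrFun hΓ t⟩

theorem IsCoveringMap.liftsTo_unique (hq : IsCoveringMap q) {z' : Y} (h : γ.LiftsTo q y z)
    (h' : γ.LiftsTo q y z') : z = z' := by
  obtain ⟨Γ, hΓ⟩ := h
  obtain ⟨Γ', hΓ'⟩ := h'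
  have := hq.eq_of_comp_eq Γ.continuous Γ'.continuous
    (funext fun t ↦ (hΓ t).trans (hΓ' t).symm) 0 (by simp)
  simpa using congrFun this 1

theorem IsCoveringMap.liftsTo_trans_iff (hq : IsCoveringMap q) :
    (γ.trans δ).LiftsTo q x z ↔ ∃ y, γ.LiftsTo q x y ∧ δ.LiftsTo q y z := by
  refine ⟨fun h ↦ ?_, fun ⟨y, h₁, h₂⟩ ↦ h₁.trans h₂⟩
  obtain ⟨y, hy⟩ := hq.exists_liftsTo γ h.source
  obtain ⟨z', hz'⟩ := hq.exists_liftsTo δ hy.target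
  obtain rfl := hq.liftsTo_unique (hy.trans hz') h
  exact ⟨y, hy, hz'⟩

end LiftsTo

theorem IsCoveringMap.surjective_of_pathConnectedSpace {X Y : Type*} [TopologicalSpace X]
    [TopologicalSpace Y] [PathConnectedSpace X] [Nonempty Y] {q : Y → X} (hq : IsCoveringMap q) :
    Function.Surjective q := fun x ↦ by
  let y : Y := Classical.arbitrary Y
  obtain ⟨z, hz⟩ := hq.exists_liftsTo (PathConnectedSpace.somePath (q y) x) rfl
  exact ⟨z, hz.target⟩

theorem IsLocalHomeomorph.locallyPathConnectedSpace {X Y : Type*} [TopologicalSpace X]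
    [TopologicalSpace Y] [LocallyPathConnectedSpace X] {q : Y → X} (hq : IsLocalHomeomorph q) :
    LocallyPathConnectedSpace Y := by
  let _ : ChartedSpace X Y :=
    { atlas := univ
      chartAt y := (hq y).choose
      mem_chart_source y := (hq y).choose_spec.1
      chart_mem_atlas _ := mem_univ _ }
  exact ChartedSpace.locallyPathConnectedSpace X Y

/-- A path connected covering space of `X : Type u` is essentially of size `u`. -/
theorem IsCoveringMap.small {X : Type u} {Y : Type w} [TopologicalSpace X] [TopologicalSpace Y]
    [PathConnectedSpace Y] {q : Y → X} (hq : IsCoveringMap q) : Small.{u} Y := by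
  let y : Y := Classical.arbitrary Y
  -- Every point of `Y` is the end of a lift of some path in `X` from `q y`, and these paths form a
  -- type in universe `u`.
  choose f hf using fun γ : Σ b : X, Path (q y) b ↦ hq.exists_liftsTo γ.2 (y := y) rfl
  refine small_of_surjective (f := f) fun z ↦ ?_
  let Γ : Path y z := PathConnectedSpace.somePath y z
  exact ⟨⟨q z, Γ.map hq.continuous⟩, hq.liftsTo_unique (hf _) ⟨Γ, fun _ ↦ rfl⟩⟩

/-! ### Uniform sections -/

/-- Every point of `X` has an open neighbourhood over which all coverings of `X` have sections
through all points. -/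
def HasUniformSections (X : Type u) [TopologicalSpace X] : Prop :=
  ∀ x : X, ∃ U, IsOpen U ∧ x ∈ U ∧ ∀ (Y : Type w) [TopologicalSpace Y] (q : Y → X),
    IsCoveringMap q → ∀ y, q y ∈ U → HasSectionThrough q U y

/-- Smallness of path connected coverings frees the universal property from its fixed universe;
pullbacks along maps between different universes need this. -/
theorem IsCategoricalUniversalCovering.exists_lift {E X : Type u} [TopologicalSpace E]
    [TopologicalSpace X] {p : E → X} (hp : IsCategoricalUniversalCovering p) {Y : Type w}
    [TopologicalSpace Y] [PathConnectedSpace Y] {q : Y → X} (hq : IsCoveringProjection q) :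
    ∃ f : E → Y, Continuous f ∧ Function.Surjective f ∧ q ∘ f = p := by
  have := hq.isCoveringMap.small
  let φ : Shrink.{u} Y ≃ₜ Y := (Shrink.homeomorph.{u, w} Y).symm
  have : PathConnectedSpace (Shrink.{u} Y) := φ.symm.surjective.pathConnectedSpace φ.symm.continuous
  obtain ⟨f, hf, hqf, -⟩ := hp.exists_unique_lift (Shrink.{u} Y) (q ∘ φ)
    ⟨hq.isCoveringMap.comp_homeomorph φ, hq.surjective.comp φ.surjective⟩
  exact ⟨φ ∘ f, φ.continuous.comp hf.isCoveringMap.continuous, φ.surjective.comp hf.surjective, hqf⟩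

theorem HasCategoricalUniversalCovering.hasUniformSections {X : Type u} [TopologicalSpace X]
    [ConnectedSpace X] [LocallyPathConnectedSpace X] (h : HasCategoricalUniversalCovering X) :
    HasUniformSections.{u, w} X := by
  obtain ⟨E, _, p, hp⟩ := h
  intro x
  obtain ⟨U, hU, hxU, hsec⟩ := hp.isCoveringProjection.isCoveringMap.exists_hasSectionThrough x
  refine ⟨U, hU, hxU, fun Y _ q hq y hy ↦ ?_⟩
  have : PathConnectedSpace X := pathConnectedSpace_iff_connectedSpace.mpr inferInstance
  have : LocallyPathConnectedSpace Y := hq.isLocalHomeomorph.locallyPathConnectedSpace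
  -- The covering space may be disconnected, while the universal property concerns path connected
  -- ones.
  let C : Set Y := pathComponent y
  have hC : IsClopen C := .pathComponent y
  have hyC : y ∈ C := mem_pathComponent_self y
  have : PathConnectedSpace C := isPathConnected_iff_pathConnectedSpace.mp isPathConnected_pathComponent
  have hqC : IsCoveringMap (C.domRestrict q) := hq.domRestrict_isClopen hC
  obtain ⟨f, hf, hfs, hqf⟩ := hp.exists_lift (q := C.domRestrict q)
    ⟨hqC, hqC.surjective_of_pathConnectedSpace⟩
  obtain ⟨e, he⟩ := hfs ⟨y, hyC⟩
  have hpe : p e = q y := by rw [← hqf, Function.comp_apply, he]; rfl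
  obtain ⟨s, hs, hps, hse⟩ := hsec e (hpe ▸ hy)
  refine ⟨fun z ↦ f (s z), (continuous_subtype_val.comp hf).comp_continuousOn hs, fun z hz ↦ ?_, ?_⟩
  · exact (congrFun hqf (s z)).trans (hps z hz)
  · simp only [← hpe, hse, he]

/-! ### The universal covering -/

/-- Two paths with the same endpoints are lift equivalent if, in every covering, their lifts that
start at the same point also end at the same point. -/
def Path.LiftEquiv {X : Type u} [TopologicalSpace X] {a b : X} (γ γ' : Path a b) : Prop :=
  ∀ (Y : Type u) [TopologicalSpace Y] (q : Y → X), IsCoveringMap q →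
    ∀ y z, γ.LiftsTo q y z ↔ γ'.LiftsTo q y z

section LiftEquiv

variable {X : Type u} [TopologicalSpace X] {a b c d : X}

theorem Path.LiftEquiv.rfl {γ : Path a b} : γ.LiftEquiv γ := fun _ _ _ _ _ _ ↦ Iff.rfl

theorem Path.LiftEquiv.symm {γ γ' : Path a b} (h : γ.LiftEquiv γ') : γ'.LiftEquiv γ :=
  fun Y _ q hq y z ↦ (h Y q hq y z).symm

theorem Path.LiftEquiv.trans {γ γ' γ'' : Path a b} (h : γ.LiftEquiv γ') (h' : γ'.LiftEquiv γ'') :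
    γ.LiftEquiv γ'' :=
  fun Y _ q hq y z ↦ (h Y q hq y z).trans (h' Y q hq y z)

theorem Path.LiftEquiv.comp {γ γ' : Path a b} {δ δ' : Path b c} (h : γ.LiftEquiv γ')
    (h' : δ.LiftEquiv δ') : (γ.trans δ).LiftEquiv (γ'.trans δ') := by
  intro Y _ q hq y z
  rw [hq.liftsTo_trans_iff, hq.liftsTo_trans_iff]
  exact _root_.exists_congr fun w ↦ and_congr (h Y q hq y w) (h' Y q hq w z)

theorem Path.LiftEquiv.assoc (γ : Path a b) (δ : Path b c) (ε : Path c d) :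
    ((γ.trans δ).trans ε).LiftEquiv (γ.trans (δ.trans ε)) := by
  intro Y _ q hq y z
  simp only [hq.liftsTo_trans_iff]
  grind

theorem Path.LiftEquiv.trans_refl (γ : Path a b) : (γ.trans (Path.refl b)).LiftEquiv γ := by
  intro Y _ q hq y z
  rw [hq.liftsTo_trans_iff]
  constructor
  · rintro ⟨w, hw, hz⟩
    rwa [hq.liftsTo_unique hz (.refl hw.target)]
  · exact fun h ↦ ⟨z, h, .refl h.target⟩

theorem Path.LiftEquiv.trans_symm_refl (δ : Path b c) :
    (δ.trans δ.symm).LiftEquiv (Path.refl b) := by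
  intro Y _ q hq y z
  constructor
  · intro h
    obtain ⟨w, h₁, h₂⟩ := hq.liftsTo_trans_iff.mp h
    rw [hq.liftsTo_unique h₂ h₁.symm]
    exact .refl h₁.source
  · intro h
    obtain ⟨w, hw⟩ := hq.exists_liftsTo δ h.source
    rw [hq.liftsTo_unique h (.refl h.source)]
    exact hw.trans hw.symm

theorem Path.LiftEquiv.trans_trans_symm (γ : Path a b) (δ : Path b c) :
    ((γ.trans δ).trans δ.symm).LiftEquiv γ :=
  (assoc _ _ _).trans ((comp .rfl (trans_symm_refl δ)).trans (trans_refl γ))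

end LiftEquiv

/-- The set `N` is open and path connected, and all paths in `N` with the same endpoints are
lift equivalent. -/
structure IsLiftSimple {X : Type u} [TopologicalSpace X] (N : Set X) : Prop where
  isOpen : IsOpen N
  isPathConnected : IsPathConnected N
  liftEquiv : ∀ {b c : X} (δ δ' : Path b c), (∀ t, δ t ∈ N) → (∀ t, δ' t ∈ N) → δ.LiftEquiv δ'

/-- A path inside `N` lifts by composition with a section, so its lift ends at the value of that
section at `c`, whichever path was taken. -/
theorem HasUniformSections.exists_isLiftSimple {X : Type u} [TopologicalSpace X]
    [LocallyPathConnectedSpace X] (h : HasUniformSections.{u, u} X) (x : X) :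
    ∃ N : Set X, x ∈ N ∧ IsLiftSimple N := by
  obtain ⟨U, hU, hxU, hsec⟩ := h x
  obtain ⟨N, hNU, hN, hxN, hconn⟩ := LocallyPathConnectedSpace.exists_isPathConnected hU hxU
  refine ⟨N, hxN, hN, hconn, fun {b c} δ δ' hδ hδ' Y _ q hq y z ↦ ?_⟩
  have key : ∀ {δ δ' : Path b c}, (∀ t, δ t ∈ N) → (∀ t, δ' t ∈ N) → δ.LiftsTo q y z →
      δ'.LiftsTo q y z := by
    intro δ δ' hδ hδ' hz
    have hy := hz.source
    have hb : b ∈ N := by simpa using hδ 0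
    obtain ⟨s, hs, hqs, hsy⟩ := (hsec Y q hq y (hNU (hy ▸ hb))).mono hNU
    rw [hy] at hsy
    have h₁ := Path.LiftsTo.of_section hs hqs hδ
    have h₂ := Path.LiftsTo.of_section hs hqs hδ'
    rw [hsy] at h₁ h₂
    rwa [hq.liftsTo_unique hz h₁]
  exact ⟨key hδ hδ', key hδ' hδ⟩

/-- Lift equivalence on the paths that start at a given point. -/
def universalCoverSetoid {X : Type u} [TopologicalSpace X] (x₀ : X) :
    Setoid (Σ b : X, Path x₀ b) where
  -- The endpoints are only propositionally equal, so `Path.LiftEquiv` does not apply directly.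
  r γ γ' := γ.1 = γ'.1 ∧ ∀ (Y : Type u) [TopologicalSpace Y] (q : Y → X), IsCoveringMap q →
    ∀ y z, γ.2.LiftsTo q y z ↔ γ'.2.LiftsTo q y z
  iseqv :=
    { refl _ := ⟨rfl, fun _ _ _ _ _ _ ↦ Iff.rfl⟩
      symm h := ⟨h.1.symm, fun Y _ q hq y z ↦ (h.2 Y q hq y z).symm⟩
      trans h h' := ⟨h.1.trans h'.1, fun Y _ q hq y z ↦ (h.2 Y q hq y z).trans (h'.2 Y q hq y z)⟩ }

/-- The paths that start at `x₀`, up to lift equivalence. -/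
def UniversalCover {X : Type u} [TopologicalSpace X] (x₀ : X) : Type u :=
  Quotient (universalCoverSetoid x₀)

namespace UniversalCover

variable {X : Type u} [TopologicalSpace X] {x₀ : X}

/-- The class of a path. -/
def mk {b : X} (γ : Path x₀ b) : UniversalCover x₀ :=
  Quotient.mk (universalCoverSetoid x₀) ⟨b, γ⟩

theorem mk_eq_mk {b : X} {γ γ' : Path x₀ b} : mk γ = mk γ' ↔ γ.LiftEquiv γ' :=
  Quotient.eq.trans ⟨fun h ↦ h.2, fun h ↦ ⟨rfl, h⟩⟩

/-- The endpoint of a class of paths. -/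
def proj : UniversalCover x₀ → X :=
  Quotient.lift (fun γ ↦ γ.1) fun _ _ h ↦ h.1

theorem proj_mk {b : X} (γ : Path x₀ b) : proj (mk γ) = b := rfl

theorem exists_mk_eq (e : UniversalCover x₀) : ∃ (b : X) (γ : Path x₀ b), mk γ = e := by
  obtain ⟨⟨b, γ⟩, rfl⟩ := Quotient.exists_rep e
  exact ⟨b, γ, rfl⟩

theorem exists_mk_eq_of_proj_eq {e : UniversalCover x₀} {b : X} (h : proj e = b) :
    ∃ γ : Path x₀ b, mk γ = e := by
  obtain ⟨c, γ, rfl⟩ := exists_mk_eq e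
  subst h
  exact ⟨γ, rfl⟩

theorem mk_trans_congr {b c : X} {γ γ' : Path x₀ b} {δ δ' : Path b c} (h : mk γ = mk γ')
    (h' : δ.LiftEquiv δ') : mk (γ.trans δ) = mk (γ'.trans δ') :=
  mk_eq_mk.mpr ((mk_eq_mk.mp h).comp h')

instance : TopologicalSpace (UniversalCover x₀) where
  IsOpen W := ∀ ⦃b : X⦄ (γ : Path x₀ b), mk γ ∈ W → ∃ N, IsOpen N ∧ b ∈ N ∧
    ∀ ⦃c : X⦄ (δ : Path b c), (∀ t, δ t ∈ N) → mk (γ.trans δ) ∈ W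
  isOpen_univ _ _ _ := ⟨univ, isOpen_univ, mem_univ _, fun _ _ _ ↦ mem_univ _⟩
  isOpen_inter := by
    intro W W' h h' b γ hγ
    obtain ⟨N, hN, hb, hW⟩ := h γ hγ.1
    obtain ⟨N', hN', hb', hW'⟩ := h' γ hγ.2
    exact ⟨N ∩ N', hN.inter hN', ⟨hb, hb'⟩,
      fun c δ hδ ↦ ⟨hW δ fun t ↦ (hδ t).1, hW' δ fun t ↦ (hδ t).2⟩⟩
  isOpen_sUnion := by
    intro S hS b γ ⟨W, hWS, hγ⟩
    obtain ⟨N, hN, hb, hW⟩ := hS W hWS γ hγ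
    exact ⟨N, hN, hb, fun c δ hδ ↦ ⟨W, hWS, hW δ hδ⟩⟩

theorem continuous_proj : Continuous (proj : UniversalCover x₀ → X) where
  isOpen_preimage N hN := by
    intro b γ hγ
    exact ⟨N, hN, hγ, fun c δ hδ ↦ by simpa using! hδ 1⟩

/-- The classes of the paths that continue `γ` by a path in `N`. -/
def sheet {b : X} (γ : Path x₀ b) (N : Set X) : Set (UniversalCover x₀) :=
  {e | ∃ (c : X) (δ : Path b c), (∀ t, δ t ∈ N) ∧ mk (γ.trans δ) = e}

theorem _root_.Path.forall_trans_mem {a b c : X} {γ : Path a b} {δ : Path b c} {N : Set X}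
    (hγ : ∀ t, γ t ∈ N) (hδ : ∀ t, δ t ∈ N) (t) : (γ.trans δ) t ∈ N := by
  rw [Path.trans_apply]
  split_ifs
  exacts [hγ _, hδ _]

theorem isOpen_sheet {b : X} (γ : Path x₀ b) {N : Set X} (hN : IsOpen N) :
    IsOpen (sheet γ N) := by
  intro c γ' ⟨d, δ, hδ, h⟩
  obtain rfl : d = c := congrArg proj h
  refine ⟨N, hN, by simpa using hδ 1, fun e ε hε ↦
    ⟨e, δ.trans ε, Path.forall_trans_mem hδ hε, ?_⟩⟩
  rw [← mk_trans_congr h .rfl, mk_eq_mk]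
  exact (Path.LiftEquiv.assoc _ _ _).symm

/-- The sheets over a lift-simple `N` continue fixed representatives of the fibre over `b` by paths
in `N`. The choice of such a path does not matter, and retracing it recovers the point of the fibre.
-/
theorem isCoveringMap_proj (h : ∀ x : X, ∃ N, x ∈ N ∧ IsLiftSimple N)
    [LocallyPathConnectedSpace X] : IsCoveringMap (proj : UniversalCover x₀ → X) := by
  intro b
  obtain ⟨N, hbN, hN⟩ := h b
  choose r hr using fun e : (proj : UniversalCover x₀ → X) ⁻¹' {b} ↦ exists_mk_eq_of_proj_eq e.2
  refine IsEvenlyCovered.of_sheets hN.isOpen hbN (fun e ↦ sheet (r e) N) ?_ ?_ ?_ ?_ ?_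
  · intro e W hW
    refine ⟨fun ho ↦ (ho.preimage continuous_proj).inter (isOpen_sheet _ hN.isOpen), fun ho ↦ ?_⟩
    rw [isOpen_iff_forall_mem_open]
    intro c hc
    obtain ⟨δ, hδ⟩ := hN.isPathConnected.joinedIn b hbN c (hW hc)
    obtain ⟨M, hM, hcM, hMW⟩ := ho ((r e).trans δ) ⟨hc, c, δ, hδ, rfl⟩
    -- Openness upstairs only controls endpoints of paths in `M`; path connectedness of `M'` makes
    -- all its points such endpoints.
    obtain ⟨M', hMM, hM', hcM', hconn⟩ :=
      LocallyPathConnectedSpace.exists_isPathConnected hM hcM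
    refine ⟨M', fun d hd ↦ ?_, hM', hcM'⟩
    obtain ⟨ε, hε⟩ := hconn.joinedIn c hcM' d hd
    exact (hMW ε fun t ↦ hMM (hε t)).1
  · rintro e _ ⟨c, δ, hδ, rfl⟩ _ ⟨d, ε, hε, rfl⟩ hcd
    obtain rfl : c = d := hcd
    exact mk_trans_congr rfl (hN.liftEquiv δ ε hδ hε)
  · intro e c hc
    obtain ⟨δ, hδ⟩ := hN.isPathConnected.joinedIn b hbN c hc
    exact ⟨mk ((r e).trans δ), ⟨c, δ, hδ, rfl⟩, rfl⟩
  · rintro e e' _ ⟨c, δ, hδ, rfl⟩ ⟨d, ε, hε, h⟩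
    obtain rfl : d = c := congrArg proj h
    apply Subtype.ext
    rw [← hr e, ← hr e', ← mk_eq_mk.mpr (Path.LiftEquiv.trans_trans_symm (r e) δ),
      ← mk_eq_mk.mpr (Path.LiftEquiv.trans_trans_symm (r e') δ), mk_trans_congr _ .rfl]
    rw [← h]
    exact mk_trans_congr rfl (hN.liftEquiv ε δ hε hδ)
  · intro e he
    obtain ⟨c, γ, rfl⟩ := exists_mk_eq e
    obtain ⟨δ, hδ⟩ := hN.isPathConnected.joinedIn b hbN c he
    refine ⟨⟨mk (γ.trans δ.symm), rfl⟩, c, δ, hδ, ?_⟩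
    rw [mk_trans_congr (hr _) .rfl, mk_eq_mk]
    simpa using Path.LiftEquiv.trans_trans_symm γ δ.symm

/-- `F` sends a class to the end of its lift from `y₀`, well defined by the very choice of the
equivalence. It is continuous because a local inverse of `q` lifts short continuations. -/
theorem exists_lift {Y : Type u} [TopologicalSpace Y] {q : Y → X} (hq : IsCoveringMap q) {y₀ : Y}
    (hy₀ : q y₀ = x₀) : ∃ F : UniversalCover x₀ → Y, Continuous F ∧ q ∘ F = proj ∧
      ∀ ⦃b : X⦄ (γ : Path x₀ b), γ.LiftsTo q y₀ (F (mk γ)) := by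
  have key : ∀ e : UniversalCover x₀, ∃ z, ∀ ⦃b : X⦄ (γ : Path x₀ b), mk γ = e →
      γ.LiftsTo q y₀ z := by
    intro e
    obtain ⟨b, γ, rfl⟩ := exists_mk_eq e
    obtain ⟨z, hz⟩ := hq.exists_liftsTo γ hy₀
    refine ⟨z, fun c γ' h ↦ ?_⟩
    obtain rfl : c = b := congrArg proj h
    exact (mk_eq_mk.mp h Y q hq _ _).mpr hz
  choose F hF using key
  have hF' : ∀ ⦃b : X⦄ (γ : Path x₀ b), γ.LiftsTo q y₀ (F (mk γ)) := fun b γ ↦ hF _ γ rfl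
  refine ⟨F, ⟨fun O hO ↦ ?_⟩, ?_, hF'⟩
  · intro b γ hγ
    obtain ⟨φ, hφ, hφq⟩ := hq.isLocalHomeomorph (F (mk γ))
    have hb : φ (F (mk γ)) = b := by rw [← hφq]; exact (hF' γ).target
    have hsb : φ.symm b = F (mk γ) := (congrArg φ.symm hb).symm.trans (φ.left_inv hφ)
    refine ⟨φ.target ∩ φ.symm ⁻¹' O, φ.symm.isOpen_inter_preimage hO,
      ⟨hb ▸ φ.map_source hφ, ?_⟩, fun c δ hδ ↦ ?_⟩
    · rw [mem_preimage, hsb]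
      exact hγ
    · have h₁ : δ.LiftsTo q (φ.symm b) (φ.symm c) :=
        .of_section (U := φ.target) φ.symm.continuousOn
          (fun x hx ↦ by rw [hφq]; exact φ.right_inv hx) fun t ↦ (hδ t).1
      rw [hsb] at h₁
      rw [mem_preimage, hq.liftsTo_unique (hF' (γ.trans δ)) ((hF' γ).trans h₁)]
      simpa using (hδ 1).2
  · funext e
    obtain ⟨b, γ, rfl⟩ := exists_mk_eq e
    exact (hF' γ).target

/-- The lift `Γ` of `γ` from the constant class ends at the class of some `γ'`. Mapping `Γ` by `F`
to any covering shows that `γ` and `γ'` have lifts with the same end there, so the two classes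
coincide and `Γ` joins the base point to `mk γ`. -/
theorem pathConnectedSpace (hp : IsCoveringMap (proj : UniversalCover x₀ → X)) :
    PathConnectedSpace (UniversalCover x₀) := by
  let e₀ : UniversalCover x₀ := mk (Path.refl x₀)
  have key : ∀ e, Joined e₀ e := by
    intro e
    obtain ⟨b, γ, rfl⟩ := exists_mk_eq e
    obtain ⟨e, Γ, hΓ⟩ := hp.exists_liftsTo γ (proj_mk (Path.refl x₀))
    obtain ⟨γ', rfl⟩ := exists_mk_eq_of_proj_eq (Path.LiftsTo.target ⟨Γ, hΓ⟩)
    refine ⟨Γ.cast rfl (mk_eq_mk.mpr fun Y _ q hq y z ↦ ?_)⟩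
    have key : q y = x₀ → ∃ w, γ.LiftsTo q y w ∧ γ'.LiftsTo q y w := by
      intro hy
      obtain ⟨F, hF, hqF, hFl⟩ := exists_lift hq hy
      refine ⟨F (mk γ'), ⟨(Γ.map hF).cast ?_ rfl, fun t ↦ ?_⟩, hFl γ'⟩
      · exact hq.liftsTo_unique (.refl hy) (hFl (Path.refl x₀))
      · exact (congrFun hqF (Γ t)).trans (hΓ t)
    constructor
    · intro h
      obtain ⟨w, h₁, h₂⟩ := key h.source
      rwa [hq.liftsTo_unique h h₁]
    · intro h
      obtain ⟨w, h₁, h₂⟩ := key h.source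
      rwa [hq.liftsTo_unique h h₂]
  exact ⟨⟨e₀⟩, fun e e' ↦ (key e).symm.trans (key e')⟩

end UniversalCover

/-- A path connected covering space that, with a base point, maps to every covering space with any
base point is a categorical universal covering. -/
theorem IsCategoricalUniversalCovering.of_exists_lift {E X : Type u} [TopologicalSpace E]
    [TopologicalSpace X] [LocallyPathConnectedSpace X] [PathConnectedSpace E] {p : E → X}
    (hp : IsCoveringProjection p) (e₀ : E)
    (hlift : ∀ (Y : Type u) [TopologicalSpace Y] (q : Y → X), IsCoveringMap q →
      ∀ y, q y = p e₀ → ∃ f : E → Y, Continuous f ∧ q ∘ f = p ∧ f e₀ = y) :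
    IsCategoricalUniversalCovering p := by
  have hcov : ∀ {Y : Type u} [TopologicalSpace Y] [PathConnectedSpace Y] {q : Y → X} {f : E → Y},
      IsCoveringMap q → Continuous f → q ∘ f = p → IsCoveringProjection f := by
    intro Y _ _ q f hq hf hqf
    have := hq.of_comp (hqf ▸ hp.isCoveringMap) hf
    exact ⟨this, this.surjective_of_pathConnectedSpace⟩
  -- A self-lift `f` taking `e₀` to `e₁` is surjective, so some `e₂` maps to `e₀`; the self-lift `g`
  -- taking `e₀` to `e₂` satisfies `f ∘ g = id` by unique lifting, and surjectivity of `g` makes it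
  -- a two-sided inverse.
  have hdeck : ∀ e₁, p e₁ = p e₀ → ∃ h : E ≃ₜ E, p ∘ h = p ∧ h e₀ = e₁ := by
    intro e₁ he₁
    obtain ⟨f, hf, hpf, hfe⟩ := hlift E p hp.isCoveringMap e₁ he₁
    have hfp := hcov hp.isCoveringMap hf hpf
    obtain ⟨e₂, he₂⟩ := hfp.surjective e₀
    obtain ⟨g, hg, hpg, hge⟩ := hlift E p hp.isCoveringMap e₂
      (by rw [← he₂]; exact (congrFun hpf e₂).symm)
    have hgp := hcov hp.isCoveringMap hg hpg
    have hfg : f ∘ g = id := by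
      refine hp.isCoveringMap.eq_of_comp_eq (hf.comp hg) continuous_id ?_ e₀ ?_
      · rw [← Function.comp_assoc, hpf, hpg, Function.comp_id]
      · rw [Function.comp_apply, hge, he₂, id]
    have hginj : Function.Injective g := Function.LeftInverse.injective (congrFun hfg)
    have hgf : Function.RightInverse f g := fun e ↦ by
      obtain ⟨e', rfl⟩ := hgp.surjective e
      exact congrArg g (congrFun hfg e')
    exact ⟨⟨⟨f, g, hgf, congrFun hfg⟩, hf, hg⟩, hpf, hfe⟩
  refine ⟨inferInstance, hp, fun Y _ _ q hq ↦ ?_⟩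
  obtain ⟨y, hy⟩ := hq.surjective (p e₀)
  obtain ⟨f, hf, hqf, hfe⟩ := hlift Y q hq.isCoveringMap y hy
  refine ⟨f, hcov hq.isCoveringMap hf hqf, hqf, fun g hg hqg ↦ ?_⟩
  obtain ⟨e₁, he₁⟩ := hg.surjective y
  -- Moving `e₀` to a preimage of `y` under `g` makes `g ∘ h` and `f` agree at `e₀`, hence
  -- everywhere.
  obtain ⟨h, hph, hhe⟩ := hdeck e₁ (by rw [← hy, ← he₁, ← hqg, Function.comp_apply])
  refine ⟨h, hq.isCoveringMap.eq_of_comp_eq (hg.isCoveringMap.continuous.comp h.continuous) hf ?_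
    e₀ ?_⟩
  · rw [← Function.comp_assoc, hqg, hph, hqf]
  · rw [Function.comp_apply, hhe, he₁, hfe]

theorem HasUniformSections.hasCategoricalUniversalCovering {X : Type u} [TopologicalSpace X]
    [ConnectedSpace X] [LocallyPathConnectedSpace X] (h : HasUniformSections.{u, u} X) :
    HasCategoricalUniversalCovering X := by
  have : PathConnectedSpace X := pathConnectedSpace_iff_connectedSpace.mpr inferInstance
  let x₀ : X := Classical.arbitrary X
  have hp : IsCoveringMap (UniversalCover.proj : UniversalCover x₀ → X) :=
    UniversalCover.isCoveringMap_proj h.exists_isLiftSimple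
  have := UniversalCover.pathConnectedSpace hp
  refine ⟨UniversalCover x₀, inferInstance, UniversalCover.proj, .of_exists_lift
    ⟨hp, hp.surjective_of_pathConnectedSpace⟩ (.mk (Path.refl x₀)) fun Y _ q hq y hy ↦ ?_⟩
  obtain ⟨F, hF, hqF, hFl⟩ := UniversalCover.exists_lift hq hy
  exact ⟨F, hF, hqF, (hq.liftsTo_unique (.refl hy) (hFl (Path.refl x₀))).symm⟩

/-! ### Retracts and one-point unions -/

/-- A covering of `A` pulled back along `r` is a covering of `X`; restricting its sections along `i`
gives sections of the original one, since `r ∘ i` is the identity. -/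
theorem HasUniformSections.of_retract {A : Type u} {X : Type v} [TopologicalSpace A]
    [TopologicalSpace X] (h : HasUniformSections.{v, max v w} X) {i : A → X} {r : X → A}
    (hi : Continuous i) (hr : Continuous r) (hri : ∀ a, r (i a) = a) :
    HasUniformSections.{u, w} A := by
  intro a
  obtain ⟨U, hU, haU, hsec⟩ := h (i a)
  refine ⟨i ⁻¹' U, hU.preimage hi, haU, fun Y _ q hq y hy ↦ ?_⟩
  obtain ⟨s, hs, hqs, hsy⟩ := hsec (r.Pullback q) Function.Pullback.fst (hq.pullback_fst hr)
    ⟨(i (q y), y), hri _⟩ hy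
  refine ⟨fun b ↦ (s (i b)).snd, ?_, fun b hb ↦ ?_, ?_⟩
  · exact (continuous_snd.comp continuous_subtype_val).comp_continuousOn
      (hs.comp hi.continuousOn fun b hb ↦ hb)
  · have h₁ : (s (i b)).fst = i b := hqs _ hb
    have h₂ : r (s (i b)).fst = q (s (i b)).snd := (s (i b)).2
    rw [← h₂, h₁, hri]
  · exact congrArg Function.Pullback.snd hsy

/-- For every map `i` into the base of a covering, the covering has partial sections along `i`
over sets that do not depend on the covering. -/
theorem HasUniformSections.exists_lift {A : Type u} [TopologicalSpace A]
    (h : HasUniformSections.{u, max u w} A) (a : A) :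
    ∃ U, IsOpen U ∧ a ∈ U ∧ ∀ {X : Type v} [TopologicalSpace X] {i : A → X}, Continuous i →
      ∀ {Y : Type w} [TopologicalSpace Y] (q : Y → X), IsCoveringMap q → ∀ y, ∀ b ∈ U, q y = i b →
        ∃ s : A → Y, ContinuousOn s U ∧ (∀ c ∈ U, q (s c) = i c) ∧ s b = y := by
  obtain ⟨U, hU, haU, hsec⟩ := h a
  refine ⟨U, hU, haU, fun {X} _ {i} hi {Y} _ q hq y b hbU hby ↦ ?_⟩
  obtain ⟨s, hs, hqs, hsy⟩ := hsec (i.Pullback q) Function.Pullback.fst (hq.pullback_fst hi)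
    ⟨(b, y), hby.symm⟩ hbU
  refine ⟨fun c ↦ (s c).snd, (continuous_snd.comp continuous_subtype_val).comp_continuousOn hs,
    fun c hc ↦ ?_, congrArg Function.Pullback.snd hsy⟩
  have h₁ : (s c).fst = c := hqs _ hc
  have h₂ : i (s c).fst = q (s c).snd := (s c).2
  rw [← h₂, h₁]

/-- Around a point of a retract at which the inclusion is open, uniform sections of the retract
yield uniform sections of the ambient space. -/
theorem HasUniformSections.exists_of_retract {A : Type u} {X : Type v} [TopologicalSpace A]
    [TopologicalSpace X] (h : HasUniformSections.{u, max u w} A) {i : A → X} {r : X → A}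
    (hi : Continuous i) (hr : Continuous r) (hri : ∀ a, r (i a) = a) {a : A} {V : Set A}
    (hV : IsOpen V) (haV : a ∈ V) (hiV : ∀ W ⊆ V, IsOpen W → IsOpen (i '' W)) :
    ∃ U, IsOpen U ∧ i a ∈ U ∧ ∀ (Y : Type w) [TopologicalSpace Y] (q : Y → X),
      IsCoveringMap q → ∀ y, q y ∈ U → HasSectionThrough q U y := by
  obtain ⟨U, hU, haU, hsec⟩ := h.exists_lift a
  refine ⟨i '' (U ∩ V), hiV _ inter_subset_right (hU.inter hV), ⟨a, ⟨haU, haV⟩, rfl⟩,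
    fun Y _ q hq y hy ↦ ?_⟩
  obtain ⟨b, ⟨hbU, -⟩, hby⟩ := hy
  obtain ⟨s, hs, hqs, hsy⟩ := hsec hi q hq y b hbU hby.symm
  refine ⟨s ∘ r, hs.comp hr.continuousOn ?_, ?_, ?_⟩
  · rintro _ ⟨c, hc, rfl⟩
    rw [hri]
    exact hc.1
  · rintro _ ⟨c, hc, rfl⟩
    rw [Function.comp_apply, hri, hqs c hc.1]
  · rw [Function.comp_apply, ← hby, hri, hsy]

namespace OnePointUnion

variable {X₁ : Type u} {X₂ : Type v} {x₁ : X₁} {x₂ : X₂}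

/-- The inclusion of the first space. -/
def inl (a : X₁) : OnePointUnion x₁ x₂ := Quot.mk _ (Sum.inl a)

/-- The inclusion of the second space. -/
def inr (b : X₂) : OnePointUnion x₁ x₂ := Quot.mk _ (Sum.inr b)

theorem inl_eq_inr : (inl x₁ : OnePointUnion x₁ x₂) = inr x₂ := Quot.sound .glue

/-- The map out of the one-point union that is given by two maps that agree at the base points. -/
def desc {Y : Type w} (f : X₁ → Y) (g : X₂ → Y) (h : f x₁ = g x₂) : OnePointUnion x₁ x₂ → Y :=
  Quot.lift (Sum.elim f g) (by rintro _ _ ⟨⟩; exact h)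

theorem exists_eq (z : OnePointUnion x₁ x₂) : (∃ a, z = inl a) ∨ ∃ b, z = inr b := by
  obtain ⟨a | b, rfl⟩ := Quot.exists_rep z
  exacts [.inl ⟨a, rfl⟩, .inr ⟨b, rfl⟩]

/-- The retraction onto the first space. -/
def retractLeft : OnePointUnion x₁ x₂ → X₁ := desc id (fun _ ↦ x₁) rfl

/-- The retraction onto the second space. -/
def retractRight : OnePointUnion x₁ x₂ → X₂ := desc (fun _ ↦ x₂) id rfl

variable [TopologicalSpace X₁] [TopologicalSpace X₂]

theorem isQuotientMap_mk :
    IsQuotientMap (Quot.mk _ : X₁ ⊕ X₂ → OnePointUnion x₁ x₂) := isQuotientMap_quot_mk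

theorem continuous_inl : Continuous (inl : X₁ → OnePointUnion x₁ x₂) :=
  isQuotientMap_mk.continuous.comp _root_.continuous_inl

theorem continuous_inr : Continuous (inr : X₂ → OnePointUnion x₁ x₂) :=
  isQuotientMap_mk.continuous.comp _root_.continuous_inr

theorem isOpen_iff {W : Set (OnePointUnion x₁ x₂)} :
    IsOpen W ↔ IsOpen (inl ⁻¹' W) ∧ IsOpen (inr ⁻¹' W) :=
  isQuotientMap_mk.isOpen_preimage.symm.trans isOpen_sum_iff

theorem continuousOn_desc {Y : Type w} [TopologicalSpace Y] {f : X₁ → Y} {g : X₂ → Y}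
    {h : f x₁ = g x₂} {W : Set (OnePointUnion x₁ x₂)} (hW : IsOpen W)
    (hf : ContinuousOn f (inl ⁻¹' W)) (hg : ContinuousOn g (inr ⁻¹' W)) :
    ContinuousOn (desc f g h) W := by
  rw [continuousOn_open_iff hW]
  intro O hO
  rw [isOpen_iff] at hW ⊢
  exact ⟨hf.isOpen_inter_preimage hW.1 hO, hg.isOpen_inter_preimage hW.2 hO⟩

theorem continuous_retractLeft : Continuous (retractLeft : OnePointUnion x₁ x₂ → X₁) :=
  continuousOn_univ.mp
    (continuousOn_desc isOpen_univ continuous_id.continuousOn continuous_const.continuousOn)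

theorem continuous_retractRight : Continuous (retractRight : OnePointUnion x₁ x₂ → X₂) :=
  continuousOn_univ.mp
    (continuousOn_desc isOpen_univ continuous_const.continuousOn continuous_id.continuousOn)

instance [LocallyPathConnectedSpace X₁] [LocallyPathConnectedSpace X₂] :
    LocallyPathConnectedSpace (OnePointUnion x₁ x₂) :=
  inferInstanceAs (LocallyPathConnectedSpace (Quot (BasePointRel x₁ x₂)))

instance [ConnectedSpace X₁] [ConnectedSpace X₂] : ConnectedSpace (OnePointUnion x₁ x₂) := by
  rw [connectedSpace_iff_univ]
  have : (univ : Set (OnePointUnion x₁ x₂)) = range inl ∪ range inr := by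
    refine (eq_univ_of_forall fun z ↦ ?_).symm
    rcases exists_eq z with ⟨a, rfl⟩ | ⟨b, rfl⟩
    exacts [.inl ⟨a, rfl⟩, .inr ⟨b, rfl⟩]
  rw [this]
  exact (isConnected_range continuous_inl).union ⟨inl x₁, ⟨x₁, rfl⟩, x₂, inl_eq_inr.symm⟩
    (isConnected_range continuous_inr)

theorem isOpen_image_inl {W : Set X₁} (hW : IsOpen W) (hx : x₁ ∉ W) :
    IsOpen (inl '' W : Set (OnePointUnion x₁ x₂)) := by
  rw [isOpen_iff]
  constructor
  · rwa [preimage_image_eq W (Function.LeftInverse.injective (g := retractLeft) fun _ ↦ rfl)]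
  · convert! isOpen_empty
    refine eq_empty_of_forall_notMem fun b ⟨a, ha, hab⟩ ↦ hx ?_
    rwa [← show a = x₁ from congrArg retractLeft hab]

theorem isOpen_image_inr {W : Set X₂} (hW : IsOpen W) (hx : x₂ ∉ W) :
    IsOpen (inr '' W : Set (OnePointUnion x₁ x₂)) := by
  rw [isOpen_iff]
  constructor
  · convert! isOpen_empty
    refine eq_empty_of_forall_notMem fun b ⟨a, ha, hab⟩ ↦ hx ?_
    rwa [← show a = x₂ from congrArg retractRight hab]
  · rwa [preimage_image_eq W (Function.LeftInverse.injective (g := retractRight) fun _ ↦ rfl)]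

theorem hasUniformSections (h₁ : HasUniformSections.{u, max u w} X₁)
    (h₂ : HasUniformSections.{v, max v w} X₂) (hx₁ : IsClosed ({x₁} : Set X₁))
    (hx₂ : IsClosed ({x₂} : Set X₂)) :
    HasUniformSections.{max u v, w} (OnePointUnion x₁ x₂) := by
  have hbase : ∃ U : Set (OnePointUnion x₁ x₂), IsOpen U ∧ inl x₁ ∈ U ∧
      ∀ (Y : Type w) [TopologicalSpace Y] (q : Y → OnePointUnion x₁ x₂),
        IsCoveringMap q → ∀ y, q y ∈ U → HasSectionThrough q U y := by
    obtain ⟨U₁, hU₁, hxU₁, hs₁⟩ := h₁.exists_lift x₁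
    obtain ⟨U₂, hU₂, hxU₂, hs₂⟩ := h₂.exists_lift x₂
    have hU : IsOpen (retractLeft ⁻¹' U₁ ∩ retractRight ⁻¹' U₂ : Set (OnePointUnion x₁ x₂)) :=
      (hU₁.preimage continuous_retractLeft).inter (hU₂.preimage continuous_retractRight)
    refine ⟨_, hU, ⟨hxU₁, hxU₂⟩, fun Y _ q hq y hy ↦ ?_⟩
    obtain ⟨s₁, s₂, hc₁, hc₂, hq₁, hq₂, hs, hsy⟩ : ∃ (s₁ : X₁ → Y) (s₂ : X₂ → Y),
        ContinuousOn s₁ U₁ ∧ ContinuousOn s₂ U₂ ∧ (∀ a ∈ U₁, q (s₁ a) = inl a) ∧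
        (∀ b ∈ U₂, q (s₂ b) = inr b) ∧ ∃ hs : s₁ x₁ = s₂ x₂, desc s₁ s₂ hs (q y) = y := by
      -- The section on the summand below `y` is chosen through `y`; the other is then chosen
      -- through its value at the base point, so that the two glue.
      rcases exists_eq (q y) with ⟨a, ha⟩ | ⟨b, hb⟩
      · rw [ha] at hy
        obtain ⟨s₁, hc₁, hq₁, hsa⟩ := hs₁ continuous_inl q hq y a hy.1 ha
        obtain ⟨s₂, hc₂, hq₂, hsb⟩ := hs₂ continuous_inr q hq (s₁ x₁) x₂ hxU₂
          ((hq₁ x₁ hxU₁).trans inl_eq_inr)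
        exact ⟨s₁, s₂, hc₁, hc₂, hq₁, hq₂, hsb.symm, by rw [ha]; exact hsa⟩
      · rw [hb] at hy
        obtain ⟨s₂, hc₂, hq₂, hsb⟩ := hs₂ continuous_inr q hq y b hy.2 hb
        obtain ⟨s₁, hc₁, hq₁, hsa⟩ := hs₁ continuous_inl q hq (s₂ x₂) x₁ hxU₁
          ((hq₂ x₂ hxU₂).trans inl_eq_inr.symm)
        exact ⟨s₁, s₂, hc₁, hc₂, hq₁, hq₂, hsa, by rw [hb]; exact hsb⟩
    refine ⟨desc s₁ s₂ hs, continuousOn_desc hU (hc₁.mono fun a ha ↦ ha.1)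
      (hc₂.mono fun b hb ↦ hb.2), fun z hz ↦ ?_, hsy⟩
    rcases exists_eq z with ⟨a, rfl⟩ | ⟨b, rfl⟩
    exacts [hq₁ a hz.1, hq₂ b hz.2]
  intro z
  rcases exists_eq z with ⟨a, rfl⟩ | ⟨b, rfl⟩
  · rcases eq_or_ne a x₁ with rfl | ha
    · exact hbase
    -- Closedness of the base point makes its complement an open set on which the inclusion is open.
    · exact h₁.exists_of_retract continuous_inl continuous_retractLeft (fun _ ↦ rfl)
        hx₁.isOpen_compl ha fun W hW hWo ↦ isOpen_image_inl hWo fun h ↦ hW h rfl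
  · rcases eq_or_ne b x₂ with rfl | hb
    · rwa [inl_eq_inr] at hbase
    · exact h₂.exists_of_retract continuous_inr continuous_retractRight (fun _ ↦ rfl)
        hx₂.isOpen_compl hb fun W hW hWo ↦ isOpen_image_inr hWo fun h ↦ hW h rfl

end OnePointUnion

theorem theorem3 {X₁ : Type u} {X₂ : Type v} [TopologicalSpace X₁] [TopologicalSpace X₂]
    [ConnectedSpace X₁] [LocallyPathConnectedSpace X₁]
    [ConnectedSpace X₂] [LocallyPathConnectedSpace X₂]
    (x₁ : X₁) (x₂ : X₂) (hx₁ : IsClosed ({x₁} : Set X₁)) (hx₂ : IsClosed ({x₂} : Set X₂)) :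
    HasCategoricalUniversalCovering (OnePointUnion x₁ x₂) ↔
      HasCategoricalUniversalCovering X₁ ∧ HasCategoricalUniversalCovering X₂ := by
  constructor
  · intro h
    have h' := h.hasUniformSections.{max u v, max u v}
    exact ⟨(HasUniformSections.of_retract.{u, max u v, u} h' OnePointUnion.continuous_inl
        OnePointUnion.continuous_retractLeft fun _ ↦ rfl).hasCategoricalUniversalCovering,
      (HasUniformSections.of_retract.{v, max u v, v} h' OnePointUnion.continuous_inr
        OnePointUnion.continuous_retractRight fun _ ↦ rfl).hasCategoricalUniversalCovering⟩
  · rintro ⟨h₁, h₂⟩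
    exact (OnePointUnion.hasUniformSections.{u, v, max u v} h₁.hasUniformSections
      h₂.hasUniformSections hx₁ hx₂).hasCategoricalUniversalCovering
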